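/- Let $n\ge 2$, let $\mathfrak g=\mathfrak{sl}_n(\mathbb C)$, and let $\mathfrak h\subset\mathfrak g$ be the Cartan subalgebra of diagonal matrices. A point $x\in\mathbb C^n$ represents the functional $H\mapsto\sum_{i=1}^n x_iH_{ii}$ on $\mathfrak h$, and two points represent the same functional if and only if they differ by a multiple of $(1,\dots,1)$. Put $\overline{x}=x-\frac{x_1+\cdots+x_n}{n}(1,\dots,1)$; for $\mu\in\mathfrak h^*$ write $\overline\mu$ for the unique point with coordinate sum $0$ that represents $\mu$. Let $\langle x,y\rangle=\sum_{i=1}^n x_iy_i$ and $\rho=(n-1,n-2,\dots,1,0)$. Let $\lambda=(\lambda_1\ge\lambda_2\ge\cdots\ge\lambda_n\ge 0)$ be a partition with at most $n$ parts, viewed as a dominant weight of $\mathfrak h$, and let $V_\lambda$ be the finite-dimensional irreducible representation of $\mathfrak{sl}_n(\mathbb C)$ of highest weight $\lambda$ (with respect to the upper triangular matrices). Write $V_\lambda(\mu)=\{v\in V_\lambda : Hv=\mu(H)v \text{ for all } H\in\mathfrak h\}$. Then \[ \frac{1}{\dim V_\lambda}\sum_{\mu}\dim V_\lambda(\mu)\,\langle\overline\mu,\overline\mu\rangle=\frac{1}{n+1}\,\big\langle\overline\lambda,\overline{\lambda+2\rho}\big\rangle,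 \] where the sum runs over the weights $\mu\in\mathfrak h^*$ of $V_\lambda$, that is, those with $V_\lambda(\mu)\ne 0$. (Here $n$ is the Coxeter number of $\mathfrak{sl}_n$.) -/

import Mathlib

open LieAlgebra.SpecialLinear

namespace TypeA

/-- The Cartan subalgebra of `sl_n(ℂ)` consisting of the diagonal traceless matrices. -/
def cartan (n : ℕ) : LieSubalgebra ℂ (sl (Fin n) ℂ) where
  carrier := {A | A.val.IsDiag}
  add_mem' := fun ha hb => ha.add hb
  zero_mem' := Matrix.isDiag_zero
  smul_mem' := fun c _ ha => Matrix.IsDiag.smul c ha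
  lie_mem' := by
    intro A B ha hb
    have ha' : A.val.IsDiag := ha
    have hb' : B.val.IsDiag := hb
    change (⁅A, B⁆ : sl (Fin n) ℂ).val.IsDiag
    rw [sl_bracket, ← ha'.diagonal_diag, ← hb'.diagonal_diag, Matrix.diagonal_mul_diagonal,
      Matrix.diagonal_mul_diagonal]
    exact (Matrix.isDiag_diagonal _).sub (Matrix.isDiag_diagonal _)

/-- The linear functional `H ↦ ∑ i, x i * H i i` on the Cartan subalgebra given by a point `x` of
`ℂⁿ`. Two points give the same functional iff they differ by a multiple of `(1, …, 1)`. -/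
noncomputable def functional {n : ℕ} (x : Fin n → ℂ) : Module.Dual ℂ (cartan n) where
  toFun := fun H => ∑ i, x i * H.val.val i i
  map_add' := by
    intro A B
    simp [mul_add, Finset.sum_add_distrib]
  map_smul' := by
    intro c A
    simp [Finset.mul_sum, mul_left_comm]

/-- The normalization `x ↦ x̄`, `x̄ i = x i - (∑ j, x j) / n`. -/
noncomputable def normalize {n : ℕ} (x : Fin n → ℂ) : Fin n → ℂ :=
  fun i => x i - (∑ j, x j) / n

/-- The diagonal traceless matrix `E_ii - (1/n) I`. -/
noncomputable def cartanElt {n : ℕ} (i : Fin n) : cartan n :=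
  ⟨⟨Matrix.diagonal (fun j => (if j = i then 1 else 0) - 1 / (n : ℂ)), by
    have hn : (n : ℂ) ≠ 0 := by exact_mod_cast (Fin.pos i).ne'
    change Matrix.trace (Matrix.diagonal (fun j : Fin n => (if j = i then 1 else 0) - 1 / (n : ℂ))) = 0
    simp [Matrix.trace_diagonal, Finset.sum_sub_distrib, hn]⟩, Matrix.isDiag_diagonal _⟩

/-- The normalized point `μ̄` of `ℂⁿ` that represents a functional `μ` on the Cartan subalgebra:
the unique point with coordinate sum zero that represents `μ`
(see `functional_normalizedPoint`, `sum_normalizedPoint`, `normalizedPoint_functional`). -/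
noncomputable def normalizedPoint {n : ℕ} (μ : Module.Dual ℂ (cartan n)) : Fin n → ℂ :=
  fun i => μ (cartanElt i)

theorem normalizedPoint_functional {n : ℕ} (x : Fin n → ℂ) :
    normalizedPoint (functional x) = normalize x := by
  funext i
  simp [normalizedPoint, functional, normalize, cartanElt, mul_sub, Finset.sum_sub_distrib,
    Finset.sum_mul, div_eq_mul_inv]

theorem sum_normalizedPoint {n : ℕ} (μ : Module.Dual ℂ (cartan n)) :
    ∑ i, normalizedPoint μ i = 0 := by
  unfold normalizedPoint
  rw [← map_sum]
  have h : ∑ i : Fin n, cartanElt i = 0 := by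
    apply Subtype.ext
    apply Subtype.ext
    ext a b
    have hn : (n : ℂ) ≠ 0 := by exact_mod_cast (Fin.pos a).ne'
    simp only [AddSubmonoidClass.coe_finsetSum, Matrix.sum_apply, cartanElt]
    by_cases hab : a = b
    · subst hab
      simp [Finset.sum_sub_distrib, hn]
    · simp [hab]
  rw [h, map_zero]

theorem functional_normalizedPoint {n : ℕ} (μ : Module.Dual ℂ (cartan n)) :
    functional (normalizedPoint μ) = μ := by
  ext H
  have hd : H.val.val.IsDiag := H.property
  have ht : ∑ i, H.val.val i i = 0 := H.val.property
  have h : H = ∑ i : Fin n, H.val.val i i • cartanElt i := by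
    apply Subtype.ext
    apply Subtype.ext
    ext a b
    simp only [AddSubmonoidClass.coe_finsetSum, Matrix.sum_apply, cartanElt]
    by_cases hab : a = b
    · subst hab
      simp [mul_sub, Finset.sum_sub_distrib, ← Finset.sum_mul, ht]
    · simp [hab, hd hab]
  conv_rhs => rw [h]
  simp [functional, normalizedPoint, mul_comm]

/-- The point `ρ = (n - 1, n - 2, …, 1, 0)`. -/
def rho (n : ℕ) : Fin n → ℂ := fun i => (n : ℂ) - 1 - (i : ℕ)

section Module

variable {n : ℕ} (V : Type*) [AddCommGroup V] [Module ℂ V] [LieRingModule (sl (Fin n) ℂ) V]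
  [LieModule ℂ (sl (Fin n) ℂ) V]

/-- The weight space `V(μ) = {v | H v = μ(H) v for all H in the Cartan subalgebra}`. -/
def weightSpace (μ : Module.Dual ℂ (cartan n)) : Submodule ℂ V :=
  (LieModule.weightSpace V (μ : cartan n → ℂ)).toSubmodule

/-- `V` has a highest weight vector of weight `μ`: a nonzero vector of `V(μ)` killed by all strictly
upper triangular elementary matrices. -/
def HasHighestWeight (μ : Module.Dual ℂ (cartan n)) : Prop :=
  ∃ v ∈ weightSpace V μ, v ≠ 0 ∧
    ∀ (i j : Fin n) (hij : i < j), ⁅single i j hij.ne (1 : ℂ), v⁆ = 0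

/-- A finite-dimensional representation has finitely many weights. -/
theorem finite_weights [FiniteDimensional ℂ V] :
    {μ : Module.Dual ℂ (cartan n) | weightSpace V μ ≠ ⊥}.Finite := by
  have : IsLieAbelian (cartan n) := by
    constructor
    intro A B
    apply Subtype.ext
    apply Subtype.ext
    have ha : A.val.val.IsDiag := A.property
    have hb : B.val.val.IsDiag := B.property
    change (⁅A.val, B.val⁆ : sl (Fin n) ℂ).val = 0
    rw [sl_bracket, ← ha.diagonal_diag, ← hb.diagonal_diag, Matrix.diagonal_mul_diagonal,
      Matrix.diagonal_mul_diagonal, sub_eq_zero]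
    simp only [mul_comm]
  have hfin := LieModule.finite_genWeightSpace_ne_bot ℂ (cartan n) V
  refine Set.Finite.of_finite_image (f := fun μ : Module.Dual ℂ (cartan n) => (μ : cartan n → ℂ))
    (hfin.subset ?_) DFunLike.coe_injective.injOn
  rintro _ ⟨μ, hμ, rfl⟩ hbot
  apply hμ
  have h := LieModule.weightSpace_le_genWeightSpace V (μ : cartan n → ℂ)
  rw [hbot, le_bot_iff] at h
  simp [weightSpace, h]

/-- The finite set of weights of a finite-dimensional representation. -/
noncomputable def weights [FiniteDimensional ℂ V] : Finset (Module.Dual ℂ (cartan n)) :=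
  (finite_weights V).toFinset

end Module

end TypeA

/-!
Let `E i j` be the matrix unit with its trace removed, `e i j` its action on `V`, and `h i = e i i`,
which acts on the weight space `V(μ)` by the `i`-th coordinate of `μ̄`. The `e i j` satisfy the
commutation relations of the matrix units, hence the Casimir operator `C = ∑ i j, e i j * e j i`
commutes with all of them.

The trace of `C` is computed in two ways. On the one hand, `C` acts on a highest weight vector by
the scalar `⟨lam̄, lam̄ + 2ρ̄⟩`, hence on all of `V` by irreducibility (`casimir_eq_smul`), and
`tr C` is `dim V` times this scalar. On the other hand, for `i ≠ j`, cyclicity of the trace and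
`h i - h j = [e i j, e j i]` give `tr ((h i - h j)²) = 2 tr (e i j * e j i)`, while `∑ i, h i = 0`.
Summing over `i` and `j`, the off-diagonal part of `tr C` is `n ∑ i, tr ((h i)²)`, so that
`tr C = (n + 1) ∑ i, tr ((h i)²)` (`apply_casimir_eq`). Finally the span of the weight vectors
is a submodule, so `V` is the direct sum of its weight spaces and `∑ i, tr ((h i)²)` is
`∑ μ, dim V(μ) ⟨μ̄, μ̄⟩` (`trace_sum_sq_eq`). No Weyl group symmetry is needed.
-/

namespace TypeA

/-! ### The commutation relations of matrix units -/

section Ring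

variable {n : ℕ} {A : Type*} [Ring A]

/-- The family `e` satisfies the commutation relations of the matrix units of `gl_n`. -/
def IsMatrixUnitFamily (e : Fin n → Fin n → A) : Prop :=
  ∀ i j k l, e i j * e k l - e k l * e i j =
    (if j = k then e i l else 0) - (if i = l then e k j else 0)

/-- The Casimir element of a family of matrix units. -/
def casimir (e : Fin n → Fin n → A) : A := ∑ i, ∑ j, e i j * e j i

theorem IsMatrixUnitFamily.casimir_commute {e : Fin n → Fin n → A} (h : IsMatrixUnitFamily e)
    (k l : Fin n) : Commute (casimir e) (e k l) := by
  have key : ∀ i j, e i j * e j i * e k l - e k l * (e i j * e j i) =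
      ((if i = k then e i j * e j l else 0) - (if j = l then e i j * e k i else 0)) +
      ((if j = k then e i l * e j i else 0) - (if i = l then e k j * e j i else 0)) := by
    intro i j
    calc _ = e i j * (e j i * e k l - e k l * e j i)
          + (e i j * e k l - e k l * e i j) * e j i := by noncomm_ring
      _ = _ := by
        rw [h, h]
        simp only [mul_sub, sub_mul, mul_ite, ite_mul, mul_zero, zero_mul]
  rw [commute_iff_eq, ← sub_eq_zero]
  simp only [casimir, Finset.sum_mul, Finset.mul_sum, ← Finset.sum_sub_distrib, key]
  simp only [Finset.sum_add_distrib, Finset.sum_sub_distrib, Finset.sum_ite_eq',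
    Finset.mem_univ, if_true]
  rw [Finset.sum_comm (f := fun i j => if i = k then e i j * e j l else 0),
    Finset.sum_comm (f := fun i j => if i = l then e k j * e j i else 0)]
  simp

/-- A linear form with `t (a * b) = t (b * a)` takes on the Casimir element the value `n + 1` times
its value on the diagonal part, if the diagonal elements of the family add up to zero. -/
theorem IsMatrixUnitFamily.apply_casimir_eq [Algebra ℂ A] {e : Fin n → Fin n → A}
    (h : IsMatrixUnitFamily e) (hsum : ∑ i, e i i = 0) (t : A →ₗ[ℂ] ℂ)
    (ht : ∀ a b, t (a * b) = t (b * a)) :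
    t (casimir e) = (n + 1) * t (∑ i, e i i * e i i) := by
  have off : ∀ i j, i ≠ j →
      t (e i j * e j i) = 2⁻¹ * t ((e i i - e j j) * (e i i - e j j)) := by
    intro i j hij
    have h1 : e i i - e j j = e i j * e j i - e j i * e i j := by simp [h i j j i]
    have h2 : (e i i - e j j) * e i j - e i j * (e i i - e j j) = 2 * e i j := by
      calc _ = (e i i * e i j - e i j * e i i) - (e j j * e i j - e i j * e j j) := by
            noncomm_ring
        _ = _ := by simp [h i i i j, h j j i j, hij, hij.symm, two_mul]
    -- `t ([x, y] * z) = t (x * [y, z])` with `x = h i - h j`, `y = e i j`, `z = e j i`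
    have h3 : t ((e i i - e j j) * (e i i - e j j)) = t (2 * e i j * e j i) := by
      calc _ = t ((e i i - e j j) * (e i j * e j i - e j i * e i j)) := by rw [← h1]
        _ = t ((e i i - e j j) * e i j * e j i) - t ((e i i - e j j) * e j i * e i j) := by
            rw [mul_sub, map_sub, mul_assoc, mul_assoc]
        _ = _ := by
            rw [ht ((e i i - e j j) * e j i), ← mul_assoc, ← map_sub, ← sub_mul, h2]
    rw [h3, two_mul, add_mul, map_add]
    ring
  have all : ∀ i j, t (e i j * e j i) = (if i = j then t (e i i * e i i) else 0) +
      2⁻¹ * t ((e i i - e j j) * (e i i - e j j)) := by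
    intro i j
    by_cases hij : i = j
    · subst hij; simp
    · simp [hij, off i j hij]
  have exp : ∑ i, ∑ j, (e i i - e j j) * (e i i - e j j) =
      (2 * n : ℂ) • ∑ i, e i i * e i i := by
    have : ∀ i j, (e i i - e j j) * (e i i - e j j) =
        e i i * e i i + e j j * e j j - e i i * e j j - e j j * e i i := by
      intro i j; noncomm_ring
    simp only [this, Finset.sum_sub_distrib, Finset.sum_add_distrib, Finset.sum_const,
      Finset.card_univ, Fintype.card_fin, ← Nat.cast_smul_eq_nsmul ℂ, ← Finset.smul_sum]
    have z1 : ∀ i, ∑ j, e i i * e j j = 0 := fun i => by rw [← Finset.mul_sum, hsum, mul_zero]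
    have z2 : ∀ i, ∑ j, e j j * e i i = 0 := fun i => by rw [← Finset.sum_mul, hsum, zero_mul]
    simp only [z1, z2, Finset.sum_const_zero, sub_zero]
    rw [← two_smul ℂ, smul_smul]
  have e1 : t (casimir e) = ∑ i, t (e i i * e i i) +
      2⁻¹ * t (∑ i, ∑ j, (e i i - e j j) * (e i i - e j j)) := by
    simp only [casimir, map_sum, Finset.mul_sum, ← Finset.sum_add_distrib]
    refine Finset.sum_congr rfl fun i _ => ?_
    rw [Finset.sum_congr rfl fun j _ => all i j, Finset.sum_add_distrib]
    simp
  rw [e1, exp, map_smul, ← map_sum, smul_eq_mul]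
  ring

end Ring

/-! ### Traceless matrix units -/

section MatrixUnits

variable {n : ℕ}

/-- The matrix unit with its trace removed, `E_ij - (δ_ij / n) I`, as an element of `sl_n`. -/
noncomputable def tracelessUnit (i j : Fin n) : sl (Fin n) ℂ :=
  if h : i = j then (cartanElt i).val else single i j h 1

theorem val_tracelessUnit (i j : Fin n) :
    (tracelessUnit i j).val = Matrix.single i j 1 - (if i = j then 1 / (n : ℂ) else 0) • 1 := by
  ext a b
  by_cases h : i = j
  · subst h
    by_cases hab : a = b
    · subst hab
      simp [tracelessUnit, cartanElt, Matrix.single_apply, eq_comm]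
    · have : ¬ (i = a ∧ i = b) := fun h => hab (h.1.symm.trans h.2)
      simp [tracelessUnit, cartanElt, hab, this]
  · simp [tracelessUnit, h]

theorem tracelessUnit_self (i : Fin n) : tracelessUnit i i = (cartanElt i).val := by
  simp [tracelessUnit]

theorem tracelessUnit_of_lt {i j : Fin n} (h : i < j) :
    tracelessUnit i j = single i j h.ne 1 := by
  simp [tracelessUnit, h.ne]

theorem tracelessUnit_bracket (i j k l : Fin n) :
    ⁅tracelessUnit i j, tracelessUnit k l⁆ =
      (if j = k then tracelessUnit i l else 0) - (if i = l then tracelessUnit k j else 0) := by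
  have hs : ∀ i j k l : Fin n, Matrix.single i j (1 : ℂ) * Matrix.single k l 1 =
      if j = k then Matrix.single i l 1 else 0 := by
    intro i j k l
    split_ifs with h
    · subst h; simp
    · simp [h]
  apply Subtype.ext
  rw [sl_bracket]
  have e1 : ((if j = k then tracelessUnit i l else 0) -
      (if i = l then tracelessUnit k j else 0) : sl (Fin n) ℂ).val =
      (if j = k then (tracelessUnit i l).val else 0) -
        (if i = l then (tracelessUnit k j).val else 0) := by
    split_ifs <;> simp
  have e2 : ∀ (a b : ℂ) (X Y : Matrix (Fin n) (Fin n) ℂ),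
      (X - a • 1) * (Y - b • 1) - (Y - b • 1) * (X - a • 1) = X * Y - Y * X := by
    intro a b X Y
    simp only [sub_mul, mul_sub, smul_mul_assoc, mul_smul_comm, one_mul, mul_one, smul_sub, smul_smul,
      mul_comm a b]
    abel
  rw [e1]
  simp only [val_tracelessUnit, e2, hs]
  by_cases h1 : j = k <;> by_cases h2 : i = l <;> simp [h1, h2, eq_comm]

theorem sum_tracelessUnit_self : ∑ i : Fin n, tracelessUnit i i = 0 := by
  apply Subtype.ext
  ext a b
  have hn : (n : ℂ) ≠ 0 := by exact_mod_cast (Fin.pos a).ne'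
  simp only [AddSubmonoidClass.coe_finsetSum, Matrix.sum_apply, val_tracelessUnit]
  by_cases hab : a = b
  · subst hab
    simp [Matrix.single_apply, Finset.sum_sub_distrib, hn]
  · have : ∀ i, ¬ (i = a ∧ i = b) := fun i h => hab (h.1.symm.trans h.2)
    simp [hab, this]

theorem eq_sum_smul_tracelessUnit (X : sl (Fin n) ℂ) :
    X = ∑ i, ∑ j, X.val i j • tracelessUnit i j := by
  have ht : ∑ i, X.val i i = 0 := X.property
  apply Subtype.ext
  simp only [AddSubmonoidClass.coe_finsetSum, SetLike.val_smul, val_tracelessUnit, smul_sub,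
    Finset.sum_sub_distrib, Matrix.smul_single, smul_eq_mul, mul_one]
  rw [← Matrix.matrix_eq_sum_single]
  simp [smul_smul, ← Finset.sum_smul, ← Finset.sum_mul, ht]

theorem eq_sum_smul_cartanElt (H : cartan n) : H = ∑ i, H.val.val i i • cartanElt i := by
  have hd : H.val.val.IsDiag := H.property
  apply Subtype.ext
  refine (eq_sum_smul_tracelessUnit H.val).trans ?_
  simp only [AddSubmonoidClass.coe_finsetSum, SetLike.val_smul, ← tracelessUnit_self]
  refine Finset.sum_congr rfl fun i _ => ?_
  refine Finset.sum_eq_single_of_mem i (Finset.mem_univ i) fun j _ hji => ?_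
  rw [show H.val.val i j = 0 from hd hji.symm, zero_smul]

end MatrixUnits

/-! ### The action on a representation -/

section Representation

variable {n : ℕ} (V : Type*) [AddCommGroup V] [Module ℂ V] [LieRingModule (sl (Fin n) ℂ) V]
  [LieModule ℂ (sl (Fin n) ℂ) V]

/-- The action of the traceless matrix units on a representation. -/
noncomputable def unitAction (i j : Fin n) : Module.End ℂ V :=
  LieModule.toEnd ℂ (sl (Fin n) ℂ) V (tracelessUnit i j)

theorem isMatrixUnitFamily_unitAction :
    IsMatrixUnitFamily (unitAction (n := n) V) := by
  intro i j k l
  ext v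
  have h := lie_lie (tracelessUnit i j) (tracelessUnit k l) v
  rw [tracelessUnit_bracket, sub_lie] at h
  simp only [unitAction, LinearMap.sub_apply, Module.End.mul_apply, LieModule.toEnd_apply_apply]
  rw [← h]
  split_ifs <;> simp

theorem sum_unitAction_self : ∑ i : Fin n, unitAction V i i = 0 := by
  simp only [unitAction]
  rw [← map_sum, sum_tracelessUnit_self, map_zero]

variable {V}

theorem mem_weightSpace_iff (μ : Module.Dual ℂ (cartan n)) (v : V) :
    v ∈ weightSpace V μ ↔ ∀ i, unitAction V i i v = normalizedPoint μ i • v := by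
  change v ∈ LieModule.weightSpace V (μ : cartan n → ℂ) ↔ _
  rw [LieModule.mem_weightSpace]
  constructor
  · intro h i
    rw [unitAction, tracelessUnit_self]
    exact h (cartanElt i)
  · intro h H
    rw [eq_sum_smul_cartanElt H, map_sum, Finset.sum_smul, sum_lie]
    refine Finset.sum_congr rfl fun i _ => ?_
    rw [smul_lie, map_smul, smul_assoc]
    congr 1
    have := h i
    rw [unitAction, tracelessUnit_self] at this
    exact this

theorem normalizedPoint_functional_of_sum_eq_zero {x : Fin n → ℂ} (hx : ∑ i, x i = 0) :
    normalizedPoint (functional x) = x := by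
  rw [normalizedPoint_functional]
  funext i
  simp [normalize, hx]

/-- The operator `e k l` shifts weights by the root `ε_k - ε_l`. -/
theorem exists_unitAction_mem_weightSpace (μ : Module.Dual ℂ (cartan n)) (k l : Fin n) {v : V}
    (hv : v ∈ weightSpace V μ) :
    ∃ ν : Module.Dual ℂ (cartan n), unitAction V k l v ∈ weightSpace V ν := by
  refine ⟨functional (normalizedPoint μ + Pi.single k 1 - Pi.single l 1), ?_⟩
  rw [mem_weightSpace_iff] at hv ⊢
  rw [normalizedPoint_functional_of_sum_eq_zero
    (by simp [Finset.sum_add_distrib, Finset.sum_sub_distrib, sum_normalizedPoint])]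
  intro i
  have h := congrArg (fun f : Module.End ℂ V => f v) (isMatrixUnitFamily_unitAction V i i k l)
  simp only [LinearMap.sub_apply, Module.End.mul_apply, hv i, map_smul] at h
  rw [sub_eq_iff_eq_add] at h
  have e1 : (if i = k then unitAction V i l else 0) v = if i = k then unitAction V k l v else 0 := by
    split_ifs with h1
    · rw [h1]
    · simp
  have e2 : (if i = l then unitAction V k i else 0) v = if i = l then unitAction V k l v else 0 := by
    split_ifs with h2
    · rw [h2]
    · simp
  rw [h, e1, e2]
  simp only [Pi.add_apply, Pi.sub_apply, Pi.single_apply, add_smul, sub_smul, ite_smul, one_smul,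
    zero_smul]
  abel

/-- Since the traceless matrix units span `sl_n`, a subspace stable under them is a
subrepresentation. -/
theorem eq_top_of_unitAction_mem [LieModule.IsIrreducible ℂ (sl (Fin n) ℂ) V] (N : Submodule ℂ V)
    (hN : ∀ i j : Fin n, ∀ v ∈ N, unitAction V i j v ∈ N) {v : V} (hv : v ∈ N) (hv0 : v ≠ 0) :
    N = ⊤ := by
  let N' : LieSubmodule ℂ (sl (Fin n) ℂ) V :=
    { N with
      lie_mem := by
        intro X m hm
        rw [eq_sum_smul_tracelessUnit X]
        simp only [sum_lie, smul_lie]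
        exact N.sum_mem fun i _ => N.sum_mem fun j _ => N.smul_mem _ (hN i j m hm) }
  have hN' : N' = ⊤ := by
    refine (eq_bot_or_eq_top N').resolve_left fun h => hv0 ?_
    have : v ∈ N' := hv
    rwa [h, LieSubmodule.mem_bot] at this
  rw [show N = N'.toSubmodule from rfl, hN', LieSubmodule.top_toSubmodule]

/-! ### The weight space decomposition -/

/-- The weight spaces add up to a submodule stable under `sl_n`, which is everything. -/
theorem isInternal_weightSpace [DecidableEq (Module.Dual ℂ (cartan n))]
    [LieModule.IsIrreducible ℂ (sl (Fin n) ℂ) V] {μ : Module.Dual ℂ (cartan n)}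
    {v : V} (hv : v ∈ weightSpace V μ) (hv0 : v ≠ 0) :
    DirectSum.IsInternal (fun μ : Module.Dual ℂ (cartan n) => weightSpace V μ) := by
  have : IsLieAbelian (cartan n) := by
    constructor
    intro A B
    apply Subtype.ext
    apply Subtype.ext
    have ha : A.val.val.IsDiag := A.property
    have hb : B.val.val.IsDiag := B.property
    change (⁅A.val, B.val⁆ : sl (Fin n) ℂ).val = 0
    rw [sl_bracket, ← ha.diagonal_diag, ← hb.diagonal_diag, Matrix.diagonal_mul_diagonal,
      Matrix.diagonal_mul_diagonal, sub_eq_zero]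
    simp only [mul_comm]
  -- independence is known for the generalized weight spaces, which contain the weight spaces
  refine DirectSum.isInternal_submodule_of_iSupIndep_of_iSup_eq_top ?_ ?_
  · have h := (LieSubmodule.iSupIndep_toSubmodule.mpr
      (LieModule.iSupIndep_genWeightSpace ℂ (cartan n) V)).comp
      (f := fun μ : Module.Dual ℂ (cartan n) => (μ : cartan n → ℂ)) DFunLike.coe_injective
    exact h.mono fun μ => LieModule.weightSpace_le_genWeightSpace V (μ : cartan n → ℂ)
  · refine eq_top_of_unitAction_mem (n := n) _ (fun k l w hw => ?_)
      (Submodule.mem_iSup_of_mem μ hv) hv0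
    induction hw using Submodule.iSup_induction' with
    | mem ν w hw =>
      obtain ⟨ν', h⟩ := exists_unitAction_mem_weightSpace ν k l hw
      exact Submodule.mem_iSup_of_mem ν' h
    | zero => simp
    | add x y _ _ hx hy => rw [map_add]; exact add_mem hx hy

theorem trace_sum_sq_eq [FiniteDimensional ℂ V]
    [LieModule.IsIrreducible ℂ (sl (Fin n) ℂ) V] {μ : Module.Dual ℂ (cartan n)}
    {v : V} (hv : v ∈ weightSpace V μ) (hv0 : v ≠ 0) :
    LinearMap.trace ℂ V (∑ i : Fin n, unitAction V i i * unitAction V i i) =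
      ∑ μ ∈ weights (n := n) V, (Module.finrank ℂ (weightSpace V μ) : ℂ) *
        (normalizedPoint μ ⬝ᵥ normalizedPoint μ) := by
  classical
  have act : ∀ (μ : Module.Dual ℂ (cartan n)), ∀ w ∈ weightSpace V μ,
      (∑ i : Fin n, unitAction V i i * unitAction V i i) w =
        (normalizedPoint μ ⬝ᵥ normalizedPoint μ) • w := by
    intro μ w hw
    rw [mem_weightSpace_iff] at hw
    simp [LinearMap.sum_apply, hw, smul_smul, dotProduct, Finset.sum_smul]
  have hmaps : ∀ μ : Module.Dual ℂ (cartan n), Set.MapsTo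
      (∑ i : Fin n, unitAction V i i * unitAction V i i : Module.End ℂ V)
      (weightSpace V μ) (weightSpace V μ) := by
    intro μ w hw
    rw [SetLike.mem_coe, act μ w hw]
    exact Submodule.smul_mem _ _ hw
  rw [LinearMap.trace_eq_sum_trace_restrict' (isInternal_weightSpace hv hv0) (finite_weights V)
    hmaps]
  refine Finset.sum_congr rfl fun μ _ => ?_
  have : LinearMap.restrict _ (hmaps μ) =
      (normalizedPoint μ ⬝ᵥ normalizedPoint μ) • LinearMap.id := by
    ext w
    exact act μ w w.2
  rw [this, map_smul, LinearMap.trace_id, smul_eq_mul, mul_comm]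

/-! ### The Casimir operator -/

/-- The value of the Casimir operator on a highest weight vector, written with `x = lam̄`: the terms
with `i > j` vanish, those with `i < j` contribute `x i - x j`. -/
theorem sum_sum_casimir_terms {x : Fin n → ℂ} (hx : ∑ i, x i = 0) :
    (∑ i, ∑ j, if i = j then x i * x i else if i < j then x i - x j else 0) =
      ∑ i, x i * (x i + 2 * rho n i) := by
  -- `x i` has total coefficient `(n - 1 - i) - i`, which differs from `2 * rho n i` by the constant
  -- `n - 1`; the constant does not matter as `∑ i, x i = 0`
  have split : ∀ i j : Fin n, (if i = j then x i * x i else if i < j then x i - x j else 0) =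
      (if i = j then x i * x i else 0) +
        ((if i < j then x i else 0) - (if i < j then x j else 0)) := by
    intro i j
    by_cases h : i = j
    · simp [h]
    · by_cases h' : i < j <;> simp [h, h']
  simp only [split, Finset.sum_add_distrib, Finset.sum_sub_distrib]
  rw [Finset.sum_comm (f := fun i j => if i < j then x j else 0)]
  have c1 : ∀ i : Fin n, ∑ j, (if i < j then x i else 0) = ((n : ℂ) - 1 - (i : ℕ)) * x i := by
    intro i
    rw [← Finset.sum_filter, Finset.sum_const, Finset.filter_lt_eq_Ioi, Fin.card_Ioi,
      nsmul_eq_mul, Nat.sub_sub, Nat.cast_sub (by omega)]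
    push_cast
    ring
  have c2 : ∀ j : Fin n, ∑ i, (if i < j then x j else 0) = ((j : ℕ) : ℂ) * x j := by
    intro j
    rw [← Finset.sum_filter, Finset.sum_const, Finset.filter_gt_eq_Iio, Fin.card_Iio,
      nsmul_eq_mul]
  simp only [c1, c2, Finset.sum_ite_eq, Finset.mem_univ, if_true]
  have e : ∀ i, x i * (x i + 2 * rho n i) =
      x i * x i + (((n : ℂ) - 1 - (i : ℕ)) * x i - ((i : ℕ) : ℂ) * x i) + ((n : ℂ) - 1) * x i := by
    intro i
    simp only [rho]
    ring
  simp only [e, Finset.sum_add_distrib, Finset.sum_sub_distrib, ← Finset.mul_sum, hx]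
  ring

theorem sum_normalize (l : Fin n → ℂ) : ∑ i, normalize l i = 0 := by
  rw [← normalizedPoint_functional, sum_normalizedPoint]

theorem normalize_dotProduct_normalize_add (l r : Fin n → ℂ) :
    normalize l ⬝ᵥ normalize (fun i => l i + r i) =
      ∑ i, normalize l i * (normalize l i + r i) := by
  have e : ∀ i, normalize l i * normalize (fun i => l i + r i) i =
      normalize l i * (normalize l i + r i) + (-(∑ j, r j) / n) * normalize l i := by
    intro i
    simp only [normalize, Finset.sum_add_distrib]
    ring
  simp only [dotProduct, e, Finset.sum_add_distrib, ← Finset.mul_sum, sum_normalize, mul_zero,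
    add_zero]

theorem casimir_apply_highestWeightVector {l : Fin n → ℂ} {v : V}
    (hv : v ∈ weightSpace V (functional l))
    (hup : ∀ (i j : Fin n) (hij : i < j), ⁅single i j hij.ne (1 : ℂ), v⁆ = 0) :
    casimir (unitAction (n := n) V) v =
      (normalize l ⬝ᵥ normalize (fun i => l i + 2 * rho n i)) • v := by
  rw [mem_weightSpace_iff, normalizedPoint_functional] at hv
  have hup' : ∀ i j : Fin n, i < j → unitAction V i j v = 0 := by
    intro i j hij
    rw [unitAction, tracelessUnit_of_lt hij]
    exact hup i j hij
  have key : ∀ i j : Fin n, unitAction V i j (unitAction V j i v) =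
      (if i = j then normalize l i * normalize l i else
        if i < j then normalize l i - normalize l j else 0) • v := by
    intro i j
    rcases lt_trichotomy i j with h | h | h
    · have := congrArg (fun f : Module.End ℂ V => f v)
        (isMatrixUnitFamily_unitAction V i j j i)
      simpa [hup' i j h, hv, h, h.ne, sub_smul] using this
    · subst h
      simp [hv, smul_smul]
    · simp [hup' j i h, h.ne', h.not_gt]
  rw [normalize_dotProduct_normalize_add, ← sum_sum_casimir_terms (sum_normalize l)]
  simp only [casimir, LinearMap.sum_apply, Module.End.mul_apply, key, Finset.sum_smul]

/-- The eigenspace of the Casimir operator that contains the highest weight vector is a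
subrepresentation. -/
theorem casimir_eq_smul [LieModule.IsIrreducible ℂ (sl (Fin n) ℂ) V] {c : ℂ} {v : V}
    (hv0 : v ≠ 0) (hv : casimir (unitAction (n := n) V) v = c • v) :
    casimir (unitAction (n := n) V) = c • LinearMap.id := by
  have h := eq_top_of_unitAction_mem (n := n)
    (Module.End.eigenspace (casimir (unitAction (n := n) V)) c) (fun i j w hw => by
      rw [Module.End.mem_eigenspace_iff] at hw ⊢
      have hc := congrArg (fun f : Module.End ℂ V => f w)
        ((isMatrixUnitFamily_unitAction V).casimir_commute i j).eq
      simp only [Module.End.mul_apply, hw, map_smul] at hc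
      exact hc)
    (Module.End.mem_eigenspace_iff.mpr hv) hv0
  ext w
  have hw : w ∈ Module.End.eigenspace (casimir (unitAction (n := n) V)) c := by simp [h]
  exact Module.End.mem_eigenspace_iff.mp hw

end Representation

end TypeA

/-! ### The second moment of the weights -/

theorem mainTheorem3 (n : ℕ) (hn : 2 ≤ n)
    -- a partition with at most `n` parts, which encodes a dominant weight
    (lam : Fin n → ℕ) (hlam : Antitone lam)
    -- the finite-dimensional irreducible representation of highest weight `lam`
    (V : Type*) [AddCommGroup V] [Module ℂ V] [FiniteDimensional ℂ V]
    [LieRingModule (sl (Fin n) ℂ) V]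
    [LieModule ℂ (sl (Fin n) ℂ) V]
    [LieModule.IsIrreducible ℂ (sl (Fin n) ℂ) V]
    (hV : TypeA.HasHighestWeight V (TypeA.functional fun i => (lam i : ℂ))) :
    1 / (Module.finrank ℂ V : ℂ) *
        ∑ μ ∈ TypeA.weights (n := n) V, (Module.finrank ℂ (TypeA.weightSpace V μ) : ℂ) *
          (TypeA.normalizedPoint μ ⬝ᵥ TypeA.normalizedPoint μ) =
      1 / ((n : ℂ) + 1) *
        (TypeA.normalize (fun i => (lam i : ℂ)) ⬝ᵥ
          TypeA.normalize (fun i => (lam i : ℂ) + 2 * TypeA.rho n i)) := by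
  obtain ⟨v, hv, hv0, hup⟩ := hV
  have hC := TypeA.casimir_eq_smul hv0 (TypeA.casimir_apply_highestWeightVector hv hup)
  have ht := (TypeA.isMatrixUnitFamily_unitAction (n := n) V).apply_casimir_eq
    (TypeA.sum_unitAction_self V) (LinearMap.trace ℂ V) (LinearMap.trace_mul_comm ℂ)
  rw [hC, map_smul, LinearMap.trace_id, TypeA.trace_sum_sq_eq hv hv0, smul_eq_mul] at ht
  have : Nontrivial V := ⟨v, 0, hv0⟩
  have hdim : (Module.finrank ℂ V : ℂ) ≠ 0 := by exact_mod_cast Module.finrank_pos.ne'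
  have hn1 : (n : ℂ) + 1 ≠ 0 := by exact_mod_cast n.succ_ne_zero
  field_simp
  linear_combination -ht
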